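/- Definitions. All topological groups are Hausdorff. A group $G$ is in SSGP$(0)$ if it is trivial; $G\in$ SSGP$(n+1)$ if for every neighborhood $U$ of $1_G$ there is a family $\mathcal H$ of subgroups of $G$, each contained in $U$, such that $K:=\overline{\langle\bigcup\mathcal H\rangle}$ is normal in $G$ and $G/K\in$ SSGP$(n)$. A norm on an abelian group $G$ is a function $\|\cdot\|:G\to[0,\infty)$ with $\|x\|=0$ iff $x=0$, $\|-x\|=\|x\|$ and $\|x+y\|\le\|x\|+\|y\|$ (not necessarily $\|kx\|=|k|\,\|x\|$); it gives $G$ the group topology of the metric $\|x-y\|$. Let $H=\mathbb Z^*_A$ be the group, under pointwise addition, of step functions $h:[0,1)\to\mathbb Z$ with finitely many steps $[a,b)$, $a,b\in A\cup\{1\}$, where $A$ is the set of dyadic rationals in $[0,1)$; put $\|h\|_H=\lambda(\{x:h(x)\ne0\})$, $\lambda$ being Lebesgue measure. For $m\ge0$ and $1\le t\le2^m$ let $e_{m,t}\in H$ be the indicator function of $[\frac{t-1}{2^m},\frac t{2^m})$, and for $r\ge0$ let $f_r=\sum_{i\ge1,\;2i-1\le2^r}e_{r,2i-1}$. Let $G$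 be an abelian group with norm $\|\cdot\|_G$. For each $m\in\mathbb Z$ let $(g_{m,t})_{t<\omega}$ be a list of the nonzero elements of $G$ of norm at most $2^{-m}$, and let $(m,t)\mapsto r(m,t)\in\mathbb N_0$ be injective on $\mathbb Z\times\mathbb N_0$. Let $S\subseteq H\oplus G$ consist of the elements $(p\,e_{m,t},0)$ ($m\ge0$, $1\le t\le2^m$, $p\in\mathbb Z\setminus\{0\}$), with provisional norm $\nu=\|p\,e_{m,t}\|_H=2^{-m}$, and the elements $(f_{r(m,t)},g_{m,t})$ ($m\in\mathbb Z$, $t<\omega$), with provisional norm $\nu=\|g_{m,t}\|_G$. For $x\in H\oplus G$ define $$\|x\|:=\inf\Big\{\sum_{i=1}^k|\alpha_i|\,\nu(s_i):\ x=\sum_{i=1}^k\alpha_is_i,\ s_i\in S,\ \alpha_i\in\mathbb Z,\ k<\omega\Big\}.\qquad(*)$$ Theorem. (1) For each $1\le n<\omega$ there is an abelian, countable, torsion-free, metrizable topological group that is in SSGP$(n)$ but not in SSGP$(n-1)$. (2) For each $0\le n<\omega$, SSGP$(n)\subseteq$ SSGP$(n+1)$, and the inclusion is proper. (3) $H$ is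 countable, torsion-free and nontrivial, $\|\cdot\|_H$ is a norm on it, and $H$ with this norm is in SSGP$(1)$. (4) Let $n\ge2$ and let $G$ be a countable torsion-free abelian group with a norm such that $G\in$ SSGP$(n-1)$ and $G\notin$ SSGP$(n-2)$. Then lists $g_{m,t}$ and injections $r$ as above exist, and for every choice of them: $S$ generates $H\oplus G$, $0\notin S$ and $\nu>0$ on $S$; $H\oplus G$ is countable and torsion-free; $(*)$ is a norm on $H\oplus G$; and $H\oplus G$ with this norm is in SSGP$(n)$ but not in SSGP$(n-1)$. (5) Consequently, starting with $G_1=H$ (with $\|\cdot\|_H$) and taking $G_{n+1}=H\oplus G_n$ with the norm $(*)$, for any choice of lists and injections at each step, one obtains for every $n\ge1$ a countable torsion-free abelian group $G_n$ with a norm, and $G_n\in$ SSGP$(n)$, $G_n\notin$ SSGP$(n-1)$. -/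

import Mathlib

open Set Topology MeasureTheory

universe u

/-- The classes `SSGP(n)`. `SSGP(0)` consists of the trivial groups; `G ∈ SSGP(n+1)` if every
neighbourhood `U` of `1` contains all members of a family `𝓗` of subgroups of `G` such that
`H`, the closure of the subgroup generated by `⋃ 𝓗`, is normal and `G ⧸ H ∈ SSGP(n)`.
It is meant for Hausdorff groups; `H` is closed, so all the quotients that occur are Hausdorff. -/
def SSGP : ℕ → (G : Type u) → [Group G] → [TopologicalSpace G] → [IsTopologicalGroup G] → Prop
  | 0, G, _, _, _ => Subsingleton G
  | n + 1, G, _, _, _ => ∀ U ∈ 𝓝 (1 : G), ∃ 𝓗 : Set (Subgroup G), (∀ K ∈ 𝓗, (K : Set G) ⊆ U) ∧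
      ∃ _ : (Subgroup.closure (⋃ K ∈ 𝓗, (K : Set G))).topologicalClosure.Normal,
        SSGP n (G ⧸ (Subgroup.closure (⋃ K ∈ 𝓗, (K : Set G))).topologicalClosure)

/-- Membership in `SSGP(n)` of the abelian group `G` with the metric topology of the group norm
`N`, that is, of the metric `N (x - y)`. A group norm need not satisfy `N (k • x) = |k| * N x`. -/
def NormSSGP (n : ℕ) {G : Type u} [AddCommGroup G] (N : AddGroupNorm G) : Prop :=
  letI : NormedAddCommGroup G := N.toNormedAddCommGroup
  SSGP n (Multiplicative G)

/-- The group of step functions `[0,1) → B` with finitely many steps `[a,b)`, whose end points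
lie in `A ∪ {1}`, under pointwise addition: `F` is the finite set of end points, and `f` takes
the same value at `x ≤ y` if no point of `F` lies in `(x,y]`. -/
def stepGroup (A : Set ℝ) (B : Type) [AddCommGroup B] : AddSubgroup (Ico (0 : ℝ) 1 → B) where
  carrier := {f | ∃ F : Finset ℝ, (F : Set ℝ) ⊆ A ∪ {1} ∧
    ∀ x y : Ico (0 : ℝ) 1, x ≤ y → (∀ c ∈ F, ¬ ((x : ℝ) < c ∧ c ≤ y)) → f x = f y}
  zero_mem' := ⟨∅, by simp, fun _ _ _ _ => rfl⟩
  add_mem' := by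
    classical
    rintro f g ⟨F, hF, hf⟩ ⟨F', hF', hg⟩
    refine ⟨F ∪ F', by rw [Finset.coe_union]; exact union_subset hF hF', fun x y hxy h => ?_⟩
    simp only [Pi.add_apply]
    rw [hf x y hxy fun c hc => h c (Finset.mem_union_left _ hc),
      hg x y hxy fun c hc => h c (Finset.mem_union_right _ hc)]
  neg_mem' := by
    rintro f ⟨F, hF, hf⟩
    exact ⟨F, hF, fun x y hxy h => by simp only [Pi.neg_apply, hf x y hxy h]⟩

/-- The dyadic rationals in `[0,1)`. -/
def dyadicPoints : Set ℝ := {x | x ∈ Ico (0 : ℝ) 1 ∧ ∃ m t : ℕ, x = t / 2 ^ m}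

/-- The group `H = ℤ*_A`, with `A` the set of dyadic rationals in `[0,1)`. -/
abbrev DyadicStep : Type := stepGroup dyadicPoints ℤ

/-- `‖h‖ = λ(Supp h)` on `H`, with `λ` the Lebesgue measure. -/
noncomputable def suppNorm (h : DyadicStep) : ℝ :=
  (volume (Subtype.val '' {x : Ico (0 : ℝ) 1 | h.1 x ≠ 0})).toReal

theorem dyadic_mem (m t : ℕ) (ht : t ≤ 2 ^ m) :
    (t : ℝ) / 2 ^ m ∈ dyadicPoints ∪ {1} := by
  rcases ht.lt_or_eq with h | h
  · refine Or.inl ⟨⟨by positivity, ?_⟩, m, t, rfl⟩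
    rw [div_lt_one (by positivity)]
    exact_mod_cast h
  · right
    subst h
    simp

open Classical in
/-- The element of `H` with value `1` on `[t/2^m, (t+1)/2^m)` and `0` elsewhere, for
`t = 0, …, 2^m - 1`. -/
noncomputable def dyadicUnit (m : ℕ) (t : Fin (2 ^ m)) : DyadicStep :=
  ⟨fun x => if (x : ℝ) ∈ Ico ((t : ℕ) / 2 ^ m : ℝ) (((t : ℕ) + 1 : ℕ) / 2 ^ m) then 1 else 0, by
    refine ⟨{((t : ℕ) / 2 ^ m : ℝ), (((t : ℕ) + 1 : ℕ) / 2 ^ m : ℝ)}, ?_, ?_⟩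
    · intro c hc
      simp only [Finset.coe_insert, Finset.coe_singleton, mem_insert_iff, mem_singleton_iff] at hc
      rcases hc with rfl | rfl
      · exact dyadic_mem m t t.2.le
      · exact dyadic_mem m (t + 1) t.2
    · intro x y hxy h
      have h1 := h _ (Finset.mem_insert_self _ _)
      have h2 := h _ (Finset.mem_insert_of_mem (Finset.mem_singleton_self _))
      have hxy' : (x : ℝ) ≤ y := hxy
      refine if_congr ?_ rfl rfl
      simp only [mem_Ico]
      constructor
      · rintro ⟨a, b⟩
        exact ⟨a.trans hxy', not_le.1 fun hc => h2 ⟨b, hc⟩⟩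
      · rintro ⟨a, b⟩
        exact ⟨not_lt.1 fun hc => h1 ⟨hc, a⟩, hxy'.trans_lt b⟩⟩

/-- The element `f_r` of `H`: the sum of the units of level `r` on every second dyadic interval,
starting with the leftmost one. -/
noncomputable def alternating (r : ℕ) : DyadicStep :=
  ∑ t : Fin (2 ^ r) with Even t.val, dyadicUnit r t

/-- The choices in the construction: for every `m : ℤ` a list `g m 0, g m 1, …` of the nonzero
elements of norm at most `1/2^m`, and an enumeration `r` of the pairs `(m,t)`. -/
structure IsListing {G : Type u} [AddCommGroup G] (N : AddGroupNorm G)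
    (g : ℤ → ℕ → G) (r : ℤ → ℕ → ℕ) : Prop where
  range_eq : ∀ m, range (g m) = {x : G | x ≠ 0 ∧ N x ≤ (2 : ℝ) ^ (-m)}
  injective : Function.Injective fun p : ℤ × ℕ => r p.1 p.2

/-- The generating set of `H ⊕ G`: the elements `(p • e, 0)`, `e` a unit of level `m` and `p ≠ 0`
an integer, and the elements `(f_{r(m,t)}, g m t)`. -/
def genSet {G : Type u} [AddCommGroup G] (g : ℤ → ℕ → G) (r : ℤ → ℕ → ℕ) :
    Set (DyadicStep × G) :=
  {s | ∃ (m : ℕ) (t : Fin (2 ^ m)) (p : ℤ), p ≠ 0 ∧ s = (p • dyadicUnit m t, 0)} ∪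
  {s | ∃ (m : ℤ) (t : ℕ), s = (alternating (r m t), g m t)}

open Classical in
/-- The provisional norm: `‖p • e‖` at the generators `(p • e, 0)` and `‖g m t‖` at the
generators `(f_{r(m,t)}, g m t)`, where `g m t ≠ 0`. Only its values on `genSet` matter. -/
noncomputable def provNorm {G : Type u} [AddCommGroup G] (N : AddGroupNorm G)
    (s : DyadicStep × G) : ℝ :=
  if s.2 = 0 then suppNorm s.1 else N s.2

/-- The function on `H ⊕ G` generated by the provisional norm: the infimum of
`∑ |α i| * ν (s i)` over all representations `x = ∑ α i • s i` with `s i` in the generating set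
and integers `α i`. -/
noncomputable def generatedNorm {G : Type u} [AddCommGroup G] (N : AddGroupNorm G)
    (g : ℤ → ℕ → G) (r : ℤ → ℕ → ℕ) (x : DyadicStep × G) : ℝ :=
  sInf {c : ℝ | ∃ (k : ℕ) (s : Fin k → DyadicStep × G) (α : Fin k → ℤ),
    (∀ i, s i ∈ genSet g r) ∧ x = ∑ i, α i • s i ∧ c = ∑ i, |(α i : ℝ)| * provNorm N (s i)}

/-- `IsStage n N`: the group `G` with the norm `N` is a possible `G_n` of the inductive
construction, where `G_1 = H` and `G_{n+1} = H ⊕ G_n` with the norm generated from the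
provisional norm. -/
inductive IsStage : ℕ → {G : Type} → [AddCommGroup G] → AddGroupNorm G → Prop
  | base (N : AddGroupNorm DyadicStep) (hN : ∀ h, N h = suppNorm h) : IsStage 1 N
  | step (n : ℕ) {G : Type} [AddCommGroup G] (N : AddGroupNorm G) (hN : IsStage n N)
      (g : ℤ → ℕ → G) (r : ℤ → ℕ → ℕ) (hgr : IsListing N g r)
      (N' : AddGroupNorm (DyadicStep × G)) (hN' : ∀ x, N' x = generatedNorm N g r x) :
      IsStage (n + 1) N'

-- Each inductive step raises the class by exactly one.
--
-- Upper bound: the cyclic group generated by a dyadic unit of level m stays in the ball of radius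
-- 2^-m, since multiples do not enlarge supports, and the units of level at least m generate H. So
-- `H ⊕ 0` is generated by arbitrarily small subgroups, and G maps onto the quotient by the closure
-- of their span. That map is continuous: each nonzero y in G is some `g m t`, and modulo `H ⊕ 0` it
-- agrees with `(alternating (r m t), g m t)`, of norm at most `N y`. The quotient is thus a
-- continuous image of G and inherits its class (`NormSSGP.succ_of_small_generators`).
--
-- Lower bound: the projection to G does not increase norms, and it kills every subgroup inside the
-- ball of radius 1/2. If `H ⊕ G` lay in a class, G would then lie in the class one lower
-- (`NormSSGP.of_small_zmultiples`).
--
-- Both the killing and the definiteness of the norm rest on `half_volume_le_of_listedSum`. The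
-- largest index occurring in a sum of alternating functions dominates: on the two halves of an
-- interval of the previous level everything else is constant, while the top term changes, so the
-- sum cannot vanish on both. A representation whose H-part has small support therefore uses only
-- indices bounded by the level of the given step function. These are finitely many because r is
-- injective.

universe v

/-! ### Permanence properties of the classes SSGP(n) -/

/-- The classes `SSGP(n)` are closed under continuous homomorphic images. -/
theorem SSGP.map_of_surjective (n : ℕ) : ∀ {G : Type u} [Group G] [TopologicalSpace G]
    [IsTopologicalGroup G] {G' : Type v} [Group G'] [TopologicalSpace G'] [IsTopologicalGroup G']
    (φ : G →* G'), Continuous φ → Function.Surjective φ → SSGP n G → SSGP n G' := by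
  induction n with
  | zero =>
    intro G _ _ _ G' _ _ _ φ _ hs h
    have h : Subsingleton G := h
    exact hs.subsingleton
  | succ n ih =>
    intro G _ _ _ G' _ _ _ φ hc hs h U hU
    have hU' : φ ⁻¹' U ∈ 𝓝 (1 : G) := hc.continuousAt.preimage_mem_nhds (by rwa [map_one])
    obtain ⟨𝓗, h𝓗, hn, hq⟩ := h _ hU'
    set K := Subgroup.closure (⋃ K ∈ 𝓗, (K : Set G)) with hK
    have himage : Subgroup.closure (⋃ L ∈ Subgroup.map φ '' 𝓗, (L : Set G')) = K.map φ := by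
      rw [hK, MonoidHom.map_closure]
      congr 1
      simp [image_iUnion]
    have hle : K.topologicalClosure.map φ ≤ (K.map φ).topologicalClosure := by
      rw [Subgroup.map_le_iff_le_comap]
      refine Subgroup.topologicalClosure_minimal _ ?_ ?_
      · rw [← Subgroup.map_le_iff_le_comap]
        exact Subgroup.le_topologicalClosure _
      · exact (Subgroup.isClosed_topologicalClosure _).preimage hc
    -- Only the closure of `K` is known to be normal, so normality is read off from the image of
    -- that closure.
    have hcl : (K.map φ).topologicalClosure = (K.topologicalClosure.map φ).topologicalClosure := by
      refine le_antisymm (Subgroup.topologicalClosure_mono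
        (Subgroup.map_mono (Subgroup.le_topologicalClosure _))) ?_
      exact Subgroup.topologicalClosure_minimal _ hle (Subgroup.isClosed_topologicalClosure _)
    have hN : (K.map φ).topologicalClosure.Normal := by
      rw [hcl]
      have := hn.map φ hs
      exact Subgroup.is_normal_topologicalClosure _
    refine ⟨Subgroup.map φ '' 𝓗, ?_, ?_⟩
    · rintro _ ⟨L, hL, rfl⟩
      rintro _ ⟨x, hx, rfl⟩
      exact h𝓗 L hL hx
    -- With `L` a variable, the equation `himage` can be substituted although the quotient type
    -- depends on the subgroup.
    · have key : ∀ L : Subgroup G', L = K.map φ →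
          ∃ _ : L.topologicalClosure.Normal, SSGP n (G' ⧸ L.topologicalClosure) := by
        rintro _ rfl
        refine ⟨hN, ih (QuotientGroup.map K.topologicalClosure (K.map φ).topologicalClosure φ
          (Subgroup.map_le_iff_le_comap.1 hle)) ?_ ?_ hq⟩
        · exact continuous_quot_lift _ (continuous_quotient_mk'.comp hc)
        · intro y
          obtain ⟨y, rfl⟩ := QuotientGroup.mk_surjective y
          obtain ⟨x, rfl⟩ := hs y
          exact ⟨QuotientGroup.mk x, rfl⟩
      exact key _ himage

/-- The same families serve at every stage; only the innermost trivial quotient needs a new family,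
the empty one. -/
theorem SSGP.succ (n : ℕ) : ∀ {G : Type u} [Group G] [TopologicalSpace G] [IsTopologicalGroup G],
    SSGP n G → SSGP (n + 1) G := by
  induction n with
  | zero =>
    intro G _ _ _ h U _
    have h : Subsingleton G := h
    refine ⟨∅, by simp, ⟨fun x _ g => by rwa [Subsingleton.elim (g * x * g⁻¹) x]⟩, ?_⟩
    exact Quotient.mk_surjective.subsingleton
  | succ n ih =>
    intro G _ _ _ h U hU
    obtain ⟨𝓗, h𝓗, hn, hq⟩ := h U hU
    exact ⟨𝓗, h𝓗, hn, ih hq⟩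

/-- In a discrete group the smallest neighbourhood of the identity is a single point. -/
theorem SSGP.of_singleton_mem_nhds {n : ℕ} {G : Type u} [Group G] [TopologicalSpace G]
    [IsTopologicalGroup G] (hG : {(1 : G)} ∈ 𝓝 (1 : G)) (h : SSGP (n + 1) G) : SSGP n G := by
  obtain ⟨𝓗, h𝓗, hn, hq⟩ := h _ hG
  have hd : DiscreteTopology G := discreteTopology_of_isOpen_singleton_one
    (mem_nhds_iff.1 hG |>.elim fun t ⟨ht, ho, h1⟩ => by
      rwa [← Subset.antisymm ht (singleton_subset_iff.2 h1)])
  have hbot : (Subgroup.closure (⋃ K ∈ 𝓗, (K : Set G))).topologicalClosure ≤ ⊥ := by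
    refine Subgroup.topologicalClosure_minimal _ ?_ (isClosed_discrete _)
    rw [Subgroup.closure_le]
    exact iUnion₂_subset fun K hK => h𝓗 K hK
  refine SSGP.map_of_surjective n (QuotientGroup.lift _ (MonoidHom.id G) fun x hx => ?_) ?_ ?_ hq
  · exact Subgroup.mem_bot.1 (hbot hx)
  · exact continuous_quot_lift _ continuous_id
  · exact fun x => ⟨QuotientGroup.mk x, rfl⟩

/-- If every subgroup in some neighbourhood of `1` is killed by a continuous surjection `φ` onto a
Hausdorff group, then `φ` lowers the index of the class. -/
theorem SSGP.of_small_subgroups_le_ker {n : ℕ} {G : Type u} [Group G] [TopologicalSpace G]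
    [IsTopologicalGroup G] {G' : Type v} [Group G'] [TopologicalSpace G'] [IsTopologicalGroup G']
    [T2Space G'] (φ : G →* G') (hc : Continuous φ) (hs : Function.Surjective φ) {U : Set G}
    (hU : U ∈ 𝓝 (1 : G)) (hker : ∀ K : Subgroup G, (K : Set G) ⊆ U → K ≤ φ.ker)
    (h : SSGP (n + 1) G) : SSGP n G' := by
  obtain ⟨𝓗, h𝓗, hn, hq⟩ := h _ hU
  have hle : (Subgroup.closure (⋃ K ∈ 𝓗, (K : Set G))).topologicalClosure ≤ φ.ker := by
    refine Subgroup.topologicalClosure_minimal _ ?_ ?_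
    · rw [Subgroup.closure_le]
      exact iUnion₂_subset fun K hK => hker K (h𝓗 K hK)
    · exact (isClosed_singleton (x := (1 : G'))).preimage hc
  refine SSGP.map_of_surjective n (QuotientGroup.lift _ φ hle) ?_ ?_ hq
  · exact continuous_quot_lift _ hc
  · intro y
    obtain ⟨x, rfl⟩ := hs y
    exact ⟨QuotientGroup.mk x, rfl⟩

/-! ### Dyadic levels of step functions -/

/-- `f` is constant on every dyadic interval `[t/2^M, (t+1)/2^M)`. -/
def IsLevel (M : ℕ) {α : Type*} (f : Ico (0 : ℝ) 1 → α) : Prop :=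
  ∀ x y : Ico (0 : ℝ) 1, ⌊2 ^ M * (x : ℝ)⌋₊ = ⌊2 ^ M * (y : ℝ)⌋₊ → f x = f y

/-- Passing from level `M + k` to level `M` drops the last `k` binary digits. -/
theorem floor_two_pow_mul_div (M k : ℕ) (x : ℝ) :
    ⌊2 ^ (M + k) * x⌋₊ / 2 ^ k = ⌊2 ^ M * x⌋₊ := by
  have h := Nat.floor_div_natCast (2 ^ (M + k) * x) (2 ^ k)
  rw [← h]
  congr 1
  push_cast
  field_simp
  ring

theorem floor_two_pow_mul_lt (M : ℕ) (x : Ico (0 : ℝ) 1) : ⌊2 ^ M * (x : ℝ)⌋₊ < 2 ^ M := by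
  rw [Nat.floor_lt (mul_nonneg (by positivity) x.2.1)]
  push_cast
  exact mul_lt_of_lt_one_right (by positivity) x.2.2

theorem IsLevel.mono {M M' : ℕ} (h : M ≤ M') {α : Type*} {f : Ico (0 : ℝ) 1 → α}
    (hf : IsLevel M f) : IsLevel M' f := by
  obtain ⟨k, rfl⟩ := Nat.exists_eq_add_of_le h
  intro x y hxy
  apply hf
  rw [← floor_two_pow_mul_div M k, ← floor_two_pow_mul_div M k, hxy]

theorem exists_common_denominator (F : Finset ℝ) (hF : (F : Set ℝ) ⊆ dyadicPoints ∪ {1}) :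
    ∃ M : ℕ, ∀ c ∈ F, ∃ t : ℕ, c = t / 2 ^ M := by
  classical
  induction F using Finset.induction_on with
  | empty => exact ⟨0, by simp⟩
  | insert a F _ ih =>
    rw [Finset.coe_insert, insert_subset_iff] at hF
    obtain ⟨M, hM⟩ := ih hF.2
    obtain ⟨m, t, ha⟩ : ∃ m t : ℕ, a = t / 2 ^ m := by
      rcases hF.1 with h | h
      · exact h.2
      · exact ⟨0, 1, by simpa using h⟩
    refine ⟨m + M, fun c hc => ?_⟩
    rcases Finset.mem_insert.1 hc with rfl | hc
    · refine ⟨t * 2 ^ M, ?_⟩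
      rw [ha]
      push_cast
      field_simp
      ring
    · obtain ⟨t, rfl⟩ := hM c hc
      refine ⟨t * 2 ^ m, ?_⟩
      push_cast
      field_simp
      ring

/-- The finitely many break points have a common denominator `2 ^ M`, and no multiple of `2^-M`
separates two points of one interval of level `M`. -/
theorem DyadicStep.exists_isLevel (h : DyadicStep) : ∃ M, IsLevel M h.1 := by
  obtain ⟨F, hF, hf⟩ := h.2
  obtain ⟨M, hM⟩ := exists_common_denominator F hF
  have key : ∀ x y : Ico (0 : ℝ) 1, x ≤ y → ⌊2 ^ M * (x : ℝ)⌋₊ = ⌊2 ^ M * (y : ℝ)⌋₊ →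
      h.1 x = h.1 y := by
    intro x y hxy hfl
    refine hf x y hxy ?_
    rintro c hc ⟨h1, h2⟩
    obtain ⟨t, rfl⟩ := hM c hc
    rw [lt_div_iff₀' (by positivity)] at h1
    rw [div_le_iff₀' (by positivity)] at h2
    have h3 : ⌊2 ^ M * (x : ℝ)⌋₊ < t :=
      (Nat.floor_lt (mul_nonneg (by positivity) x.2.1)).2 h1
    have h4 : t ≤ ⌊2 ^ M * (y : ℝ)⌋₊ := Nat.le_floor h2
    omega
  refine ⟨M, fun x y hfl => ?_⟩
  rcases le_total x y with hxy | hxy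
  · exact key x y hxy hfl
  · exact (key y x hxy hfl.symm).symm

theorem mem_Ico_dyadic_iff (m t : ℕ) {x : ℝ} (hx : 0 ≤ x) :
    x ∈ Ico (t / 2 ^ m : ℝ) ((t + 1 : ℕ) / 2 ^ m) ↔ ⌊2 ^ m * x⌋₊ = t := by
  rw [Nat.floor_eq_iff (mul_nonneg (by positivity) hx), mem_Ico, div_le_iff₀' (by positivity),
    lt_div_iff₀' (by positivity)]
  push_cast
  rfl

theorem dyadicUnit_apply (m : ℕ) (t : Fin (2 ^ m)) (x : Ico (0 : ℝ) 1) :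
    (dyadicUnit m t).1 x = if ⌊2 ^ m * (x : ℝ)⌋₊ = t then 1 else 0 :=
  if_congr (mem_Ico_dyadic_iff m t x.2.1) rfl rfl

theorem DyadicStep.sum_apply {ι : Type*} (s : Finset ι) (f : ι → DyadicStep)
    (x : Ico (0 : ℝ) 1) : (∑ i ∈ s, f i).1 x = ∑ i ∈ s, (f i).1 x := by
  change ((stepGroup dyadicPoints ℤ).subtype (∑ i ∈ s, f i)) x = _
  rw [map_sum, Finset.sum_apply]
  rfl

theorem DyadicStep.zsmul_apply (n : ℤ) (f : DyadicStep) (x : Ico (0 : ℝ) 1) :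
    (n • f).1 x = n * f.1 x := by
  change (n • f.1) x = _
  simp

theorem alternating_apply (r : ℕ) (x : Ico (0 : ℝ) 1) :
    (alternating r).1 x = if Even ⌊2 ^ r * (x : ℝ)⌋₊ then 1 else 0 := by
  rw [alternating, DyadicStep.sum_apply, Finset.sum_filter]
  rw [Finset.sum_eq_single (⟨_, floor_two_pow_mul_lt r x⟩ : Fin (2 ^ r))]
  · simp [dyadicUnit_apply]
  · intro t _ ht
    have h : ¬ ⌊2 ^ r * (x : ℝ)⌋₊ = t := fun h => ht (Fin.ext h.symm)
    rw [dyadicUnit_apply, if_neg h, ite_self]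
  · simp

theorem alternating_isLevel (r : ℕ) : IsLevel r (alternating r).1 := by
  intro x y h
  rw [alternating_apply, alternating_apply, h]

/-- The left end point `t/2^m` of a dyadic interval. -/
noncomputable def dyadicPoint (m : ℕ) (t : Fin (2 ^ m)) : Ico (0 : ℝ) 1 :=
  ⟨(t : ℕ) / 2 ^ m, by positivity, by
    rw [div_lt_one (by positivity)]
    exact_mod_cast t.2⟩

theorem floor_dyadicPoint (m : ℕ) (t : Fin (2 ^ m)) :
    ⌊2 ^ m * (dyadicPoint m t : ℝ)⌋₊ = t := by
  rw [dyadicPoint, mul_div_cancel₀ _ (by positivity), Nat.floor_natCast]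

theorem DyadicStep.eq_sum_of_isLevel {m : ℕ} {h : DyadicStep} (hh : IsLevel m h.1) :
    h = ∑ t : Fin (2 ^ m), h.1 (dyadicPoint m t) • dyadicUnit m t := by
  refine Subtype.ext (funext fun x => ?_)
  rw [DyadicStep.sum_apply, Finset.sum_eq_single (⟨_, floor_two_pow_mul_lt m x⟩ : Fin (2 ^ m))]
  · rw [DyadicStep.zsmul_apply, dyadicUnit_apply, if_pos rfl, mul_one]
    exact hh _ _ (floor_dyadicPoint m ⟨_, floor_two_pow_mul_lt m x⟩).symm
  · intro t _ ht
    rw [DyadicStep.zsmul_apply, dyadicUnit_apply, if_neg fun h => ht (Fin.ext h.symm), mul_zero]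
  · simp

instance DyadicStep.instCountable : Countable DyadicStep := by
  have : Function.Surjective fun p : (Σ m : ℕ, (Fin (2 ^ m) → ℤ)) =>
      (∑ t, p.2 t • dyadicUnit p.1 t : DyadicStep) := by
    intro h
    obtain ⟨m, hm⟩ := h.exists_isLevel
    exact ⟨⟨m, fun t => h.1 (dyadicPoint m t)⟩, (eq_sum_of_isLevel hm).symm⟩
  exact this.countable

instance DyadicStep.instIsAddTorsionFree : IsAddTorsionFree DyadicStep where
  nsmul_right_injective n hn f g hfg := by
    refine Subtype.ext (funext fun x => ?_)
    have h : (n • f.1) x = (n • g.1) x := congrFun (congrArg Subtype.val hfg) x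
    simpa [hn] using h

/-! ### The support norm on H -/

theorem volume_image_val_ne_top (A : Set (Ico (0 : ℝ) 1)) :
    volume (Subtype.val '' A) ≠ ⊤ :=
  ((measure_mono (Subtype.coe_image_subset _ A)).trans_lt measure_Ico_lt_top).ne

theorem suppNorm_eq (h : DyadicStep) : suppNorm h = volume.real (Subtype.val '' {x | h.1 x ≠ 0}) :=
  rfl

theorem suppNorm_nonneg (h : DyadicStep) : 0 ≤ suppNorm h := ENNReal.toReal_nonneg

theorem suppNorm_zero : suppNorm 0 = 0 := by
  rw [suppNorm_eq]
  simp

theorem suppNorm_neg (h : DyadicStep) : suppNorm (-h) = suppNorm h := by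
  rw [suppNorm_eq, suppNorm_eq]
  congr 2
  ext x
  simp

theorem suppNorm_add_le (h k : DyadicStep) : suppNorm (h + k) ≤ suppNorm h + suppNorm k := by
  rw [suppNorm_eq, suppNorm_eq, suppNorm_eq]
  refine le_trans (measureReal_mono ?_ ?_) (measureReal_union_le _ _)
  · rw [← image_union]
    refine image_mono fun x hx => ?_
    by_contra hc
    simp only [mem_union, mem_ofPred_eq, not_or, not_not] at hc
    exact hx (show h.1 x + k.1 x = 0 by rw [hc.1, hc.2, add_zero])
  · rw [← image_union]
    exact volume_image_val_ne_top _

/-- Integer multiples do not enlarge the support, so a ball contains the whole cyclic group of each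
of its elements. This is the source of small subgroups. -/
theorem suppNorm_zsmul_le (n : ℤ) (h : DyadicStep) : suppNorm (n • h) ≤ suppNorm h := by
  rw [suppNorm_eq, suppNorm_eq]
  refine measureReal_mono (image_mono fun x hx hc => hx ?_) (volume_image_val_ne_top _)
  rw [DyadicStep.zsmul_apply, hc, mul_zero]

theorem suppNorm_zsmul_dyadicUnit {m : ℕ} (t : Fin (2 ^ m)) {p : ℤ} (hp : p ≠ 0) :
    suppNorm (p • dyadicUnit m t) = (1 / 2) ^ m := by
  have hset : (Subtype.val '' {x | (p • dyadicUnit m t).1 x ≠ 0} : Set ℝ) =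
      Ico ((t : ℕ) / 2 ^ m : ℝ) (((t : ℕ) + 1 : ℕ) / 2 ^ m) := by
    ext x
    constructor
    · rintro ⟨x, hx, rfl⟩
      rw [mem_Ico_dyadic_iff m t x.2.1]
      by_contra hc
      refine hx ?_
      rw [DyadicStep.zsmul_apply, dyadicUnit_apply, if_neg hc, mul_zero]
    · intro hx
      have h0 : 0 ≤ x := le_trans (by positivity) hx.1
      have h1 : x < 1 := by
        refine hx.2.trans_le ?_
        rw [div_le_one (by positivity)]
        exact_mod_cast t.2
      refine ⟨⟨x, h0, h1⟩, ?_, rfl⟩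
      rw [mem_ofPred_eq, DyadicStep.zsmul_apply, dyadicUnit_apply,
        if_pos ((mem_Ico_dyadic_iff m t h0).1 hx), mul_one]
      exact hp
  rw [suppNorm_eq, hset, Real.volume_real_Ico_of_le (by gcongr; simp)]
  push_cast
  rw [← sub_div, add_sub_cancel_left, one_div_pow]

/-- Around a point where `h` is nonzero, the support contains an entire dyadic interval. -/
theorem suppNorm_pos {h : DyadicStep} (hh : h ≠ 0) : 0 < suppNorm h := by
  obtain ⟨m, hm⟩ := h.exists_isLevel
  obtain ⟨x, hx⟩ : ∃ x, h.1 x ≠ 0 := by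
    by_contra! hc
    exact hh (Subtype.ext (funext hc))
  have h1 := suppNorm_zsmul_dyadicUnit (⟨_, floor_two_pow_mul_lt m x⟩ : Fin (2 ^ m)) one_ne_zero
  have h2 : 0 < suppNorm ((1 : ℤ) • dyadicUnit m ⟨_, floor_two_pow_mul_lt m x⟩) := by
    rw [h1]
    positivity
  refine h2.trans_le (measureReal_mono (image_mono fun y hy => ?_) (volume_image_val_ne_top _))
  rw [mem_ofPred_eq, one_zsmul, dyadicUnit_apply, ite_ne_right_iff] at hy
  rw [mem_ofPred_eq, hm y x hy.1]
  exact hx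

/-- `λ(Supp h)` as a group norm on `H`. -/
noncomputable def suppGroupNorm : AddGroupNorm DyadicStep where
  toFun := suppNorm
  map_zero' := suppNorm_zero
  add_le' := suppNorm_add_le
  neg' := suppNorm_neg
  eq_zero_of_map_eq_zero' _ hh := by_contra fun h => (suppNorm_pos h).ne' hh

/-! ### The halving estimate for alternating functions -/

/-- The point on the other half of the dyadic interval of level `s` that contains `x`. -/
theorem exists_other_half (s : ℕ) (x : Ico (0 : ℝ) 1) : ∃ y : Ico (0 : ℝ) 1,
    (y : ℝ) = (if Even ⌊2 ^ (s + 1) * (x : ℝ)⌋₊ then (x : ℝ) + 1 / 2 ^ (s + 1)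
      else x - 1 / 2 ^ (s + 1)) ∧
    ⌊2 ^ s * (y : ℝ)⌋₊ = ⌊2 ^ s * (x : ℝ)⌋₊ ∧
    (Even ⌊2 ^ (s + 1) * (y : ℝ)⌋₊ ↔ ¬ Even ⌊2 ^ (s + 1) * (x : ℝ)⌋₊) := by
  have hlt := floor_two_pow_mul_lt (s + 1) x
  have hx0 : 0 ≤ 2 ^ (s + 1) * (x : ℝ) := mul_nonneg (by positivity) x.2.1
  have hle := Nat.floor_le hx0
  have hlt' := Nat.lt_floor_add_one (2 ^ (s + 1) * (x : ℝ))
  set n := ⌊2 ^ (s + 1) * (x : ℝ)⌋₊ with hn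
  have hpow : 2 ^ (s + 1) = 2 * 2 ^ s := pow_succ' 2 s
  -- `n'` is `n` with its last binary digit flipped, so it indexes the sibling half.
  obtain ⟨n', hn', hy, hdiv, hev⟩ : ∃ n' : ℕ, n' < 2 ^ (s + 1) ∧
      (n' : ℝ) - n = (if Even n then 1 else -1) ∧ n' / 2 = n / 2 ∧ (Even n' ↔ ¬ Even n) := by
    by_cases h : Even n
    · obtain ⟨j, hj⟩ := h
      refine ⟨n + 1, by omega, by simp [hj], by omega, by rw [Nat.even_add_one]⟩
    · obtain ⟨j, hj⟩ := Nat.not_even_iff_odd.1 h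
      refine ⟨n - 1, by omega, ?_, by omega, ?_⟩
      · rw [if_neg h, hj]
        push_cast
        simp
      · simp [hj]
  set y : ℝ := if Even n then (x : ℝ) + 1 / 2 ^ (s + 1) else x - 1 / 2 ^ (s + 1) with hydef
  have hmul : 2 ^ (s + 1) * y = 2 ^ (s + 1) * x + (n' - n) := by
    rw [hy, hydef]
    split_ifs <;> field_simp
    ring
  have hp : (0 : ℝ) < 2 ^ (s + 1) := by positivity
  have hy0 : 0 ≤ 2 ^ (s + 1) * y := by
    have : (0 : ℝ) ≤ n' := by positivity
    linarith
  have hfl : ⌊2 ^ (s + 1) * y⌋₊ = n' := by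
    rw [Nat.floor_eq_iff hy0]
    constructor <;> linarith
  have hy1 : 2 ^ (s + 1) * y < 2 ^ (s + 1) * 1 := by
    have : (n' : ℝ) + 1 ≤ 2 ^ (s + 1) := by exact_mod_cast hn'
    linarith
  refine ⟨⟨y, nonneg_of_mul_nonneg_right hy0 hp, lt_of_mul_lt_mul_left hy1 hp.le⟩, rfl, ?_, ?_⟩
  · have h1 := floor_two_pow_mul_div s 1 y
    have h2 := floor_two_pow_mul_div s 1 (x : ℝ)
    rw [← h1, ← h2, ← hn, hfl, pow_one, hdiv]
  · rw [hfl, hev]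

/-- On a union `A` of dyadic intervals of level `s`, a function of level `s` cannot cancel a
nonzero multiple of `f_{s+1}` on more than half of `A`. -/
theorem half_volume_le (s : ℕ) {A : Set (Ico (0 : ℝ) 1)} (hA : IsLevel s (· ∈ A))
    {w : Ico (0 : ℝ) 1 → ℤ} (hw : IsLevel s w) {a : ℤ} (ha : a ≠ 0) :
    volume.real (Subtype.val '' A) / 2 ≤ volume.real
      (Subtype.val '' {x | x ∈ A ∧ w x + a * (alternating (s + 1)).1 x ≠ 0}) := by
  set v : Ico (0 : ℝ) 1 → ℤ := fun x => w x + a * (alternating (s + 1)).1 x with hv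
  set Z : Set ℝ := Subtype.val '' {x | x ∈ A ∧ v x = 0} with hZ
  set Y : Set ℝ := Subtype.val '' {x | x ∈ A ∧ v x ≠ 0} with hY
  -- `E` separates left halves, to be shifted right, from right halves, to be shifted left. Only `E`
  -- has to be measurable for the volumes of `Z` and `Y` to split along it.
  set E : Set ℝ := {x | Even ⌊2 ^ (s + 1) * x⌋₊} with hE
  have hEm : MeasurableSet E := by
    have : Measurable fun x : ℝ => ⌊2 ^ (s + 1) * x⌋₊ :=
      Nat.measurable_floor.comp (measurable_const_mul _)
    exact this (MeasurableSet.of_discrete (s := {n : ℕ | Even n}))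
  -- On sibling points `w` agrees and the alternating function differs by 1, so `v` vanishing at
  -- both would give `a = 0`.
  have hother : ∀ x : Ico (0 : ℝ) 1, x ∈ A → v x = 0 → ∃ y : Ico (0 : ℝ) 1,
      (y ∈ A ∧ v y ≠ 0) ∧ ((y : ℝ) ∈ E ↔ (x : ℝ) ∉ E) ∧
      (y : ℝ) = (if (x : ℝ) ∈ E then (x : ℝ) + 1 / 2 ^ (s + 1) else x - 1 / 2 ^ (s + 1)) := by
    intro x hxA hx0
    obtain ⟨y, hy, hfl, hev⟩ := exists_other_half s x
    refine ⟨y, ⟨?_, fun hy0 => ?_⟩, hev, ?_⟩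
    · exact (hA y x hfl).mpr hxA
    · simp only [hv, alternating_apply, hev, hw y x hfl] at hx0 hy0
      split_ifs at hx0 hy0 <;> omega
    · rw [hy]
      rfl
  have h1 : volume (Z ∩ E) ≤ volume (Y \ E) := by
    rw [← measure_preimage_add_right volume (1 / 2 ^ (s + 1) : ℝ) (Y \ E)]
    refine measure_mono ?_
    rintro _ ⟨⟨x, ⟨hxA, hx0⟩, rfl⟩, hxE⟩
    obtain ⟨y, hy, hev, hyx⟩ := hother x hxA hx0
    rw [if_pos hxE] at hyx
    rw [mem_preimage, ← hyx]
    exact ⟨⟨y, hy, rfl⟩, fun h => hev.1 h hxE⟩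
  have h2 : volume (Z \ E) ≤ volume (Y ∩ E) := by
    rw [← measure_preimage_add_right volume (-(1 / 2 ^ (s + 1)) : ℝ) (Y ∩ E)]
    refine measure_mono ?_
    rintro _ ⟨⟨x, ⟨hxA, hx0⟩, rfl⟩, hxE⟩
    obtain ⟨y, hy, hev, hyx⟩ := hother x hxA hx0
    rw [if_neg hxE] at hyx
    rw [mem_preimage, ← sub_eq_add_neg, ← hyx]
    exact ⟨⟨y, hy, rfl⟩, hev.2 hxE⟩
  have h3 : volume Z ≤ volume Y := by
    rw [← measure_inter_add_sdiff Z hEm, ← measure_inter_add_sdiff Y hEm, add_comm]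
    exact add_le_add h2 h1
  have h4 : volume.real Z ≤ volume.real Y :=
    ENNReal.toReal_mono (volume_image_val_ne_top _) h3
  have h5 : volume.real (Subtype.val '' A) ≤ volume.real Z + volume.real Y := by
    refine le_trans (measureReal_mono ?_ ?_) (measureReal_union_le _ _)
    · rw [hZ, hY, ← image_union]
      refine image_mono fun x hx => ?_
      by_cases h : v x = 0
      · exact Or.inl ⟨hx, h⟩
      · exact Or.inr ⟨hx, h⟩
    · rw [hZ, hY, ← image_union]
      exact volume_image_val_ne_top _
  linarith

/-! ### The generated norm on H ⊕ G -/

section GeneratedNorm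

variable {G : Type u} [AddCommGroup G] {N : AddGroupNorm G} {g : ℤ → ℕ → G} {r : ℤ → ℕ → ℕ}

/-- The combination `∑ β(m,t) • (f_{r(m,t)}, g m t)`. -/
noncomputable def listedSum (g : ℤ → ℕ → G) (r : ℤ → ℕ → ℕ) :
    (ℤ × ℕ →₀ ℤ) →ₗ[ℤ] DyadicStep × G :=
  Finsupp.linearCombination ℤ fun p => (alternating (r p.1 p.2), g p.1 p.2)

/-- The cost `∑ |β(m,t)| * ‖g m t‖`. -/
noncomputable def listedCost (N : AddGroupNorm G) (g : ℤ → ℕ → G) (β : ℤ × ℕ →₀ ℤ) : ℝ :=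
  β.sum fun p a => |(a : ℝ)| * N (g p.1 p.2)

theorem listedCost_eq_sum (N : AddGroupNorm G) (g : ℤ → ℕ → G) {β : ℤ × ℕ →₀ ℤ}
    {P : Finset (ℤ × ℕ)} (hP : β.support ⊆ P) :
    listedCost N g β = ∑ p ∈ P, |(β p : ℝ)| * N (g p.1 p.2) :=
  Finsupp.sum_of_support_subset _ hP _ (by simp)

theorem listedCost_nonneg (N : AddGroupNorm G) (g : ℤ → ℕ → G) (β : ℤ × ℕ →₀ ℤ) :
    0 ≤ listedCost N g β :=
  Finset.sum_nonneg fun _ _ => mul_nonneg (abs_nonneg _) (apply_nonneg N _)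

theorem abs_mul_le_listedCost (N : AddGroupNorm G) (g : ℤ → ℕ → G) (β : ℤ × ℕ →₀ ℤ)
    (p : ℤ × ℕ) : |(β p : ℝ)| * N (g p.1 p.2) ≤ listedCost N g β := by
  classical
  rw [listedCost_eq_sum N g (Finset.subset_insert p β.support)]
  exact Finset.single_le_sum (f := fun p : ℤ × ℕ => |(β p : ℝ)| * N (g p.1 p.2))
    (fun _ _ => mul_nonneg (abs_nonneg _) (apply_nonneg N _)) (Finset.mem_insert_self _ _)

theorem listedCost_add_le (N : AddGroupNorm G) (g : ℤ → ℕ → G) (β γ : ℤ × ℕ →₀ ℤ) :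
    listedCost N g (β + γ) ≤ listedCost N g β + listedCost N g γ := by
  classical
  rw [listedCost_eq_sum N g (P := β.support ∪ γ.support) Finsupp.support_add,
    listedCost_eq_sum N g (P := β.support ∪ γ.support) Finset.subset_union_left,
    listedCost_eq_sum N g (P := β.support ∪ γ.support) Finset.subset_union_right,
    ← Finset.sum_add_distrib]
  refine Finset.sum_le_sum fun p _ => ?_
  rw [← add_mul, Finsupp.add_apply, Int.cast_add]
  exact mul_le_mul_of_nonneg_right (abs_add_le _ _) (apply_nonneg N _)

/-- A group norm need not be homogeneous, but the triangle inequality gives `N (a • x) ≤ |a| * N x`.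
This is what makes the projection to `G` norm-nonincreasing. -/
theorem apply_listedSum_snd_le (N : AddGroupNorm G) (g : ℤ → ℕ → G) (r : ℤ → ℕ → ℕ)
    (β : ℤ × ℕ →₀ ℤ) : N (listedSum g r β).2 ≤ listedCost N g β := by
  have hz : ∀ (a : ℤ) (x : G), N (a • x) ≤ |(a : ℝ)| * N x := by
    have hn : ∀ (k : ℕ) (x : G), N (k • x) ≤ k * N x := by
      intro k x
      induction k with
      | zero => simp
      | succ k ih =>
        rw [succ_nsmul]
        refine (map_add_le_add N _ _).trans ?_
        push_cast
        linarith
    intro a x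
    have h := hn a.natAbs x
    rw [Nat.cast_natAbs, Int.cast_abs] at h
    refine le_trans (le_of_eq ?_) h
    rcases Int.natAbs_eq a with ha | ha
    · conv_lhs => rw [ha]
      rw [natCast_zsmul]
    · conv_lhs => rw [ha]
      rw [neg_zsmul, natCast_zsmul, map_neg_eq_map]
  rw [listedSum, Finsupp.linearCombination_apply, Finsupp.sum, Prod.snd_sum]
  refine (Finset.le_sum_of_subadditive N (map_zero N).le (map_add_le_add N) _ _).trans ?_
  exact Finset.sum_le_sum fun p _ => hz _ _

/-- `x` has a representation of cost at most `c` in which the multiples of dyadic units are merged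
into one step function and equal generators `(f_{r(m,t)}, g m t)` are collected. -/
def IsRepr (N : AddGroupNorm G) (g : ℤ → ℕ → G) (r : ℤ → ℕ → ℕ) (x : DyadicStep × G)
    (c : ℝ) : Prop :=
  ∃ (h : DyadicStep) (β : ℤ × ℕ →₀ ℤ), x = (h, 0) + listedSum g r β ∧
    suppNorm h + listedCost N g β ≤ c

theorem IsRepr.zero : IsRepr N g r 0 0 :=
  ⟨0, 0, by rw [map_zero, add_zero]; rfl, by simp [suppNorm_zero, listedCost]⟩

theorem IsRepr.add {x y : DyadicStep × G} {c d : ℝ} (hx : IsRepr N g r x c)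
    (hy : IsRepr N g r y d) : IsRepr N g r (x + y) (c + d) := by
  obtain ⟨h, β, rfl, hc⟩ := hx
  obtain ⟨k, γ, rfl, hd⟩ := hy
  refine ⟨h + k, β + γ, ?_, ?_⟩
  · have : ((h + k, 0) : DyadicStep × G) = (h, 0) + (k, 0) := by simp
    rw [this, map_add]
    abel
  · linarith [suppNorm_add_le h k, listedCost_add_le N g β γ]

theorem IsListing.ne_zero (hl : IsListing N g r) (m : ℤ) (t : ℕ) : g m t ≠ 0 := by
  have h : g m t ∈ range (g m) := mem_range_self t
  rw [hl.range_eq] at h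
  exact h.1

theorem provNorm_listed (hl : IsListing N g r) (m : ℤ) (t : ℕ) :
    provNorm N (alternating (r m t), g m t) = N (g m t) :=
  if_neg (hl.ne_zero m t)

theorem provNorm_prod_zero (N : AddGroupNorm G) (h : DyadicStep) :
    provNorm N (h, 0) = suppNorm h :=
  if_pos rfl

theorem IsRepr.zsmul_of_mem (hl : IsListing N g r) {s : DyadicStep × G} (hs : s ∈ genSet g r)
    (a : ℤ) : IsRepr N g r (a • s) (|(a : ℝ)| * provNorm N s) := by
  rcases hs with ⟨m, t, p, -, rfl⟩ | ⟨m, t, rfl⟩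
  · rcases eq_or_ne a 0 with rfl | ha
    · simpa using IsRepr.zero
    refine ⟨a • p • dyadicUnit m t, 0, by simp, ?_⟩
    rw [provNorm_prod_zero]
    have h1 : (1 : ℝ) ≤ |(a : ℝ)| := by exact_mod_cast Int.one_le_abs ha
    have h2 := suppNorm_zsmul_le a (p • dyadicUnit m t)
    have h3 := suppNorm_nonneg (p • dyadicUnit m t)
    simp only [listedCost, Finsupp.sum_zero_index, add_zero]
    nlinarith
  · refine ⟨0, Finsupp.single (m, t) a, ?_, ?_⟩
    · rw [listedSum, Finsupp.linearCombination_single]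
      simp
    · rw [provNorm_listed hl, suppNorm_zero, listedCost, Finsupp.sum_single_index (by simp),
        zero_add]

theorem provNorm_nonneg (N : AddGroupNorm G) (s : DyadicStep × G) : 0 ≤ provNorm N s := by
  unfold provNorm
  split_ifs
  · exact suppNorm_nonneg _
  · exact apply_nonneg N _

/-- The set of costs whose infimum is `generatedNorm N g r x`. -/
def costs (N : AddGroupNorm G) (g : ℤ → ℕ → G) (r : ℤ → ℕ → ℕ) (x : DyadicStep × G) : Set ℝ :=
  {c : ℝ | ∃ (k : ℕ) (s : Fin k → DyadicStep × G) (α : Fin k → ℤ),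
    (∀ i, s i ∈ genSet g r) ∧ x = ∑ i, α i • s i ∧ c = ∑ i, |(α i : ℝ)| * provNorm N (s i)}

theorem generatedNorm_eq (N : AddGroupNorm G) (g : ℤ → ℕ → G) (r : ℤ → ℕ → ℕ)
    (x : DyadicStep × G) : generatedNorm N g r x = sInf (costs N g r x) :=
  rfl

/-- Merging terms never raises the cost, by subadditivity of both parts. Lower bounds for the
infimum can thus be proved on merged representations, and no converse is needed. -/
theorem IsRepr.of_mem_costs (hl : IsListing N g r) {x : DyadicStep × G} {c : ℝ}
    (hc : c ∈ costs N g r x) : IsRepr N g r x c := by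
  obtain ⟨k, s, α, hs, rfl, rfl⟩ := hc
  have key : ∀ P : Finset (Fin k),
      IsRepr N g r (∑ i ∈ P, α i • s i) (∑ i ∈ P, |(α i : ℝ)| * provNorm N (s i)) := by
    classical
    intro P
    induction P using Finset.induction_on with
    | empty => simpa using IsRepr.zero
    | insert i P hi ih =>
      rw [Finset.sum_insert hi, Finset.sum_insert hi]
      exact (IsRepr.zsmul_of_mem hl (hs i) (α i)).add ih
  exact key _

theorem costs_nonneg {x : DyadicStep × G} {c : ℝ} (hc : c ∈ costs N g r x) : 0 ≤ c := by
  obtain ⟨k, s, α, hs, rfl, rfl⟩ := hc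
  exact Finset.sum_nonneg fun _ _ => mul_nonneg (abs_nonneg _) (provNorm_nonneg N _)

theorem costs_bddBelow (x : DyadicStep × G) : BddBelow (costs N g r x) :=
  ⟨0, fun _ hc => costs_nonneg hc⟩

theorem generatedNorm_le {x : DyadicStep × G} {c : ℝ} (hc : c ∈ costs N g r x) :
    generatedNorm N g r x ≤ c :=
  csInf_le (costs_bddBelow x) hc

theorem generatedNorm_nonneg (x : DyadicStep × G) : 0 ≤ generatedNorm N g r x :=
  Real.sInf_nonneg fun _ hc => costs_nonneg hc

theorem costs_add {x y : DyadicStep × G} {c d : ℝ} (hc : c ∈ costs N g r x)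
    (hd : d ∈ costs N g r y) : c + d ∈ costs N g r (x + y) := by
  obtain ⟨k, s, α, hs, rfl, rfl⟩ := hc
  obtain ⟨l, s', α', hs', rfl, rfl⟩ := hd
  refine ⟨k + l, Fin.append s s', Fin.append α α', fun i => ?_, ?_, ?_⟩
  · induction i using Fin.addCases with
    | left i => simpa using hs i
    | right i => simpa using hs' i
  · simp [Fin.sum_univ_add]
  · simp [Fin.sum_univ_add]

theorem costs_neg {x : DyadicStep × G} {c : ℝ} (hc : c ∈ costs N g r x) :
    c ∈ costs N g r (-x) := by
  obtain ⟨k, s, α, hs, rfl, rfl⟩ := hc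
  exact ⟨k, s, fun i => -α i, hs, by simp, by simp⟩

theorem costs_of_mem {s : DyadicStep × G} (hs : s ∈ genSet g r) :
    provNorm N s ∈ costs N g r s :=
  ⟨1, fun _ => s, fun _ => 1, fun _ => hs, by simp, by simp⟩

theorem costs_zero : (0 : ℝ) ∈ costs N g r 0 :=
  ⟨0, Fin.elim0, Fin.elim0, fun i => i.elim0, by simp, by simp⟩

/-- Lists with very negative index cover balls of arbitrarily large radius, which is why `m` ranges
over all integers. -/
theorem IsListing.exists_eq (hl : IsListing N g r) {x : G} (hx : x ≠ 0) :
    ∃ m t, g m t = x := by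
  obtain ⟨n, hn⟩ := pow_unbounded_of_one_lt (N x) (one_lt_two : (1 : ℝ) < 2)
  have h : x ∈ range (g (-n : ℤ)) := by
    rw [hl.range_eq]
    refine ⟨hx, ?_⟩
    rw [neg_neg, zpow_natCast]
    exact hn.le
  obtain ⟨t, ht⟩ := h
  exact ⟨_, t, ht⟩

theorem prod_zero_mem_closure_genSet (g : ℤ → ℕ → G) (r : ℤ → ℕ → ℕ) (h : DyadicStep) :
    ((h, 0) : DyadicStep × G) ∈ AddSubgroup.closure (genSet g r) := by
  obtain ⟨m, hm⟩ := h.exists_isLevel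
  have hmem : h ∈ (AddSubgroup.closure (genSet g r)).comap (AddMonoidHom.inl DyadicStep G) := by
    rw [DyadicStep.eq_sum_of_isLevel hm]
    refine AddSubgroup.sum_mem _ fun t _ => AddSubgroup.zsmul_mem _ ?_ _
    exact AddSubgroup.subset_closure (Or.inl ⟨m, t, 1, one_ne_zero, by simp⟩)
  exact hmem

theorem closure_genSet (hl : IsListing N g r) : AddSubgroup.closure (genSet g r) = ⊤ := by
  rw [AddSubgroup.eq_top_iff']
  rintro ⟨h, x⟩
  rcases eq_or_ne x 0 with rfl | hx
  · exact prod_zero_mem_closure_genSet g r h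
  · obtain ⟨m, t, rfl⟩ := hl.exists_eq hx
    have h1 := prod_zero_mem_closure_genSet g r (h - alternating (r m t))
    have h2 : (alternating (r m t), g m t) ∈ AddSubgroup.closure (genSet g r) :=
      AddSubgroup.subset_closure (Or.inr ⟨m, t, rfl⟩)
    simpa using add_mem h1 h2

theorem costs_nonempty (hl : IsListing N g r) (x : DyadicStep × G) :
    (costs N g r x).Nonempty := by
  have hx : x ∈ AddSubgroup.closure (genSet g r) := closure_genSet hl ▸ AddSubgroup.mem_top x
  induction hx using AddSubgroup.closure_induction with
  | mem s hs => exact ⟨_, costs_of_mem hs⟩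
  | zero => exact ⟨0, costs_zero⟩
  | add x y _ _ hx hy => exact hx.elim fun c hc => hy.elim fun d hd => ⟨_, costs_add hc hd⟩
  | neg x _ hx => exact hx.elim fun c hc => ⟨c, costs_neg hc⟩

theorem exists_isRepr_lt (hl : IsListing N g r) {x : DyadicStep × G} {ε : ℝ}
    (h : generatedNorm N g r x < ε) : ∃ c < ε, IsRepr N g r x c := by
  obtain ⟨c, hc, hlt⟩ := exists_lt_of_csInf_lt (costs_nonempty hl x) h
  exact ⟨c, hlt, IsRepr.of_mem_costs hl hc⟩

theorem apply_snd_le_of_isRepr {x : DyadicStep × G} {c : ℝ} (hx : IsRepr N g r x c) :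
    N x.2 ≤ c := by
  obtain ⟨h, β, rfl, hc⟩ := hx
  have h1 := apply_listedSum_snd_le N g r β
  simp only [Prod.snd_add, zero_add]
  linarith [suppNorm_nonneg h]

theorem apply_snd_le_generatedNorm (hl : IsListing N g r) (x : DyadicStep × G) :
    N x.2 ≤ generatedNorm N g r x :=
  le_csInf (costs_nonempty hl x) fun _ hc => apply_snd_le_of_isRepr (IsRepr.of_mem_costs hl hc)

theorem DyadicStep.sub_apply (f h : DyadicStep) (x : Ico (0 : ℝ) 1) :
    (f - h).1 x = f.1 x - h.1 x :=
  rfl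

theorem listedSum_fst_apply (g : ℤ → ℕ → G) (r : ℤ → ℕ → ℕ) (β : ℤ × ℕ →₀ ℤ)
    (x : Ico (0 : ℝ) 1) :
    (listedSum g r β).1.1 x = ∑ p ∈ β.support, β p * (alternating (r p.1 p.2)).1 x := by
  rw [listedSum, Finsupp.linearCombination_apply, Finsupp.sum, Prod.fst_sum,
    DyadicStep.sum_apply]
  exact Finset.sum_congr rfl fun p _ => DyadicStep.zsmul_apply _ _ _

/-- If `h` has level `M` and some `f_r` with `r > M` occurs in `∑ β • f`, then `h - ∑ β • f` is
nonzero on at least half of every union `A` of dyadic intervals of level `M`. -/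
theorem half_volume_le_of_listedSum
    (hr : Function.Injective fun p : ℤ × ℕ => r p.1 p.2) {M : ℕ} {h : DyadicStep}
    (hh : IsLevel M h.1) {A : Set (Ico (0 : ℝ) 1)} (hA : IsLevel M (· ∈ A)) {β : ℤ × ℕ →₀ ℤ}
    (hβ : ∃ p ∈ β.support, M < r p.1 p.2) :
    volume.real (Subtype.val '' A) / 2 ≤ suppNorm (h - (listedSum g r β).1) := by
  classical
  obtain ⟨q, hq, hMq⟩ := hβ
  -- The largest index is attained only once, by injectivity of `r`. All other terms then have level
  -- `s`, one below the top, and are absorbed into `w`.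
  obtain ⟨p, hp, hmax⟩ := β.support.exists_max_image (fun p => r p.1 p.2) ⟨q, hq⟩
  obtain ⟨s, hs⟩ : ∃ s, r p.1 p.2 = s + 1 := Nat.exists_eq_add_one.2 (by have := hmax q hq; omega)
  have hMs : M ≤ s := by have := hmax q hq; omega
  set w : Ico (0 : ℝ) 1 → ℤ := fun x =>
    h.1 x - ∑ p ∈ β.support.erase p, β p * (alternating (r p.1 p.2)).1 x with hw
  have hlev : IsLevel s w := by
    intro x y hxy
    simp only [hw]
    rw [hh.mono hMs x y hxy]
    congr 1
    refine Finset.sum_congr rfl fun p' hp' => ?_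
    have h1 := hmax p' (Finset.mem_of_mem_erase hp')
    have h2 : r p'.1 p'.2 ≠ r p.1 p.2 := fun h => Finset.ne_of_mem_erase hp' (hr h)
    rw [(alternating_isLevel _).mono (by omega : r p'.1 p'.2 ≤ s) x y hxy]
  have key := half_volume_le s (hA.mono hMs) hlev
    (neg_ne_zero.2 (Finsupp.mem_support_iff.1 hp))
  refine key.trans (measureReal_mono (image_mono ?_) (volume_image_val_ne_top _))
  rintro x ⟨-, hx⟩
  rw [mem_ofPred_eq, DyadicStep.sub_apply, listedSum_fst_apply,
    ← Finset.add_sum_erase _ _ hp, hs]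
  intro h0
  refine hx ?_
  simp only [hw]
  linarith

/-- Finitely many pairs have index at most `M`, and their `g`-values are nonzero. Cheap
representations therefore either avoid low indices or use them with bounded coefficients. -/
theorem IsListing.exists_pos_le (hl : IsListing N g r) (M : ℕ) :
    {p : ℤ × ℕ | r p.1 p.2 ≤ M}.Finite ∧
      ∃ δ > 0, ∀ p : ℤ × ℕ, r p.1 p.2 ≤ M → δ ≤ N (g p.1 p.2) := by
  have hfin : {p : ℤ × ℕ | r p.1 p.2 ≤ M}.Finite :=
    (finite_Iic M).preimage hl.injective.injOn
  refine ⟨hfin, ?_⟩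
  have hpos : ∀ p : ℤ × ℕ, 0 < N (g p.1 p.2) := fun p =>
    map_pos_of_ne_zero N (hl.ne_zero p.1 p.2)
  rcases {p : ℤ × ℕ | r p.1 p.2 ≤ M}.eq_empty_or_nonempty with he | hne
  · exact ⟨1, one_pos, fun p hp => absurd (show p ∈ {p : ℤ × ℕ | r p.1 p.2 ≤ M} from hp)
      (he ▸ notMem_empty p)⟩
  · obtain ⟨p, -, hmin⟩ := exists_min_image _ (fun p : ℤ × ℕ => N (g p.1 p.2)) hfin hne
    exact ⟨_, hpos p, fun q hq => hmin q hq⟩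

theorem one_le_abs_of_mem_support {β : ℤ × ℕ →₀ ℤ} {p : ℤ × ℕ} (hp : p ∈ β.support) :
    (1 : ℝ) ≤ |(β p : ℝ)| := by
  exact_mod_cast Int.one_le_abs (Finsupp.mem_support_iff.1 hp)

theorem eq_zero_of_generatedNorm_eq_zero (hl : IsListing N g r) {x : DyadicStep × G}
    (hx : generatedNorm N g r x = 0) : x = 0 := by
  obtain ⟨h, y⟩ := x
  obtain rfl : y = 0 := by
    have h1 := apply_snd_le_generatedNorm hl (h, y)
    rw [hx] at h1
    exact (map_eq_zero_iff_eq_zero N).1 (le_antisymm h1 (apply_nonneg N _))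
  by_contra hne
  have hh : h ≠ 0 := fun h0 => hne (by rw [h0]; rfl)
  obtain ⟨M, hM⟩ := h.exists_isLevel
  obtain ⟨-, δ, hδ, hδle⟩ := hl.exists_pos_le M
  have hpos := suppNorm_pos hh
  -- Cost below `δ` excludes every index up to `M`; H-part below half of `suppNorm h` then
  -- contradicts the halving estimate on the support of `h`, or, if `β = 0`, the equality `k = h`.
  obtain ⟨c, hc, k, β, hk, hcost⟩ := exists_isRepr_lt hl
    (hx.trans_lt (lt_min hδ (half_pos hpos)))
  have hk' : k = h - (listedSum g r β).1 := by
    rw [eq_sub_iff_add_eq]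
    exact (congrArg Prod.fst hk).symm
  have hle : ∀ p ∈ β.support, M < r p.1 p.2 := by
    intro p hp
    by_contra hcon
    have h1 := hδle p (not_lt.1 hcon)
    have h2 := abs_mul_le_listedCost N g β p
    have h3 := one_le_abs_of_mem_support hp
    have h4 : 1 * N (g p.1 p.2) ≤ |(β p : ℝ)| * N (g p.1 p.2) :=
      mul_le_mul_of_nonneg_right h3 (apply_nonneg N _)
    linarith [suppNorm_nonneg k, hc.trans_le (min_le_left _ _)]
  have hcs : suppNorm k < suppNorm h / 2 := by
    linarith [listedCost_nonneg N g β, hc.trans_le (min_le_right _ _)]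
  rcases β.support.eq_empty_or_nonempty with he | ⟨p, hp⟩
  · rw [Finsupp.support_eq_empty.1 he, map_zero] at hk'
    rw [hk', Prod.fst_zero, sub_zero] at hcs
    linarith
  · have hA : IsLevel M (· ∈ {x | h.1 x ≠ 0}) := by
      intro x y hxy
      simp only [mem_ofPred_eq, hM x y hxy]
    have h1 := half_volume_le_of_listedSum (g := g) hl.injective hM hA ⟨p, hp, hle p hp⟩
    rw [← hk', ← suppNorm_eq] at h1
    linarith

/-- The generated norm, as a group norm. -/
noncomputable def generatedGroupNorm (hl : IsListing N g r) : AddGroupNorm (DyadicStep × G) where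
  toFun := generatedNorm N g r
  map_zero' := le_antisymm (generatedNorm_le costs_zero) (generatedNorm_nonneg _)
  add_le' x y := by
    rw [generatedNorm_eq N g r x, generatedNorm_eq N g r y]
    refine le_of_forall_pos_lt_add fun ε hε => ?_
    obtain ⟨c, hc, hc'⟩ := Real.lt_sInf_add_pos (costs_nonempty hl x) (half_pos hε)
    obtain ⟨d, hd, hd'⟩ := Real.lt_sInf_add_pos (costs_nonempty hl y) (half_pos hε)
    linarith [generatedNorm_le (costs_add hc hd)]
  neg' x := by
    rw [generatedNorm_eq, generatedNorm_eq]
    congr 1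
    ext c
    exact ⟨fun h => by simpa using costs_neg h, costs_neg⟩
  eq_zero_of_map_eq_zero' _ h := eq_zero_of_generatedNorm_eq_zero hl h

/-- Small subgroups of `H ⊕ G` lie in `H ⊕ 0`. -/
theorem eq_zero_of_zsmul_generatedNorm_lt [IsAddTorsionFree G] (hl : IsListing N g r)
    {x : DyadicStep × G} (hx : ∀ k : ℤ, generatedNorm N g r (k • x) < 1 / 2) : x.2 = 0 := by
  by_contra hne
  obtain ⟨M, hM⟩ := x.1.exists_isLevel
  obtain ⟨hfin, δ, hδ, hδle⟩ := hl.exists_pos_le M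
  -- Each coefficient satisfies `|β p| * δ ≤ cost < 1 / 2`.
  obtain ⟨C, hC⟩ := exists_nat_gt (1 / 2 / δ)
  set P := hfin.toFinset with hP
  -- All multiples of `x.2` fall in one finite set, which torsion-freeness forbids. The set is
  -- independent of `k` because `k • x.1` keeps the level `M` of `x.1`.
  have hmem : ∀ k : ℤ, k • x.2 ∈ range fun b : P → Icc (-(C : ℤ)) C =>
      ∑ p : P, (b p : ℤ) • g p.1.1 p.1.2 := by
    intro k
    obtain ⟨c, hc, h, β, hk, hcost⟩ := exists_isRepr_lt hl (hx k)
    have hh : h = k • x.1 - (listedSum g r β).1 := by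
      rw [eq_sub_iff_add_eq]
      exact (congrArg Prod.fst hk).symm
    have hsupp : β.support ⊆ P := by
      intro p hp
      rw [hP, Finite.mem_toFinset, mem_ofPred_eq]
      by_contra hcon
      have hkx : IsLevel M (k • x.1).1 := by
        intro y z hyz
        rw [DyadicStep.zsmul_apply, DyadicStep.zsmul_apply, hM y z hyz]
      -- Applied to all of `[0,1)`, the estimate forces support at least 1/2; this fixes the radius
      -- in the hypothesis.
      have h1 := half_volume_le_of_listedSum (g := g) (A := univ) hl.injective hkx
        (fun _ _ _ => rfl) ⟨p, hp, not_le.1 hcon⟩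
      rw [← hh, image_univ, Subtype.range_coe, Real.volume_real_Ico_of_le zero_le_one] at h1
      linarith [listedCost_nonneg N g β]
    have hbound : ∀ p ∈ P, β p ∈ Icc (-(C : ℤ)) C := by
      intro p hp
      rw [hP, Finite.mem_toFinset] at hp
      rw [mem_Icc, ← abs_le]
      have h1 := abs_mul_le_listedCost N g β p
      have h2 : |(β p : ℝ)| * δ ≤ |(β p : ℝ)| * N (g p.1 p.2) :=
        mul_le_mul_of_nonneg_left (hδle p hp) (abs_nonneg _)
      have h3 : |(β p : ℝ)| < C := by
        refine lt_of_le_of_lt ?_ hC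
        rw [le_div_iff₀ hδ]
        linarith [suppNorm_nonneg h]
      have h4 : |β p| < (C : ℤ) := by exact_mod_cast h3
      exact h4.le
    refine ⟨fun p => ⟨β p, hbound p p.2⟩, ?_⟩
    have h5 : k • x.2 = (listedSum g r β).2 := by
      have := congrArg Prod.snd hk
      simpa using this
    rw [h5, listedSum, Finsupp.linearCombination_apply,
      Finsupp.sum_of_support_subset _ hsupp _ (by simp), Prod.snd_sum]
    exact Finset.sum_coe_sort P fun p => β p • g p.1 p.2
  have hinj : Function.Injective fun k : ℤ => k • x.2 := fun a b hab =>
    sub_eq_zero.1 ((IsAddTorsionFree.zsmul_eq_zero_iff_left hne).1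
      ((sub_zsmul x.2 a b).trans (add_neg_eq_zero.2 hab)))
  exact (infinite_range_of_injective hinj) ((finite_range _).subset (range_subset_iff.2 hmem))

end GeneratedNorm

/-! ### Transfer between group norms and the classes SSGP(n) -/

section NormedGroups

variable {A : Type u} [AddCommGroup A] {G : Type v} [AddCommGroup G]

theorem mem_nhds_one_multiplicative_iff (N : AddGroupNorm A) (U : Set (Multiplicative A)) :
    letI : NormedAddCommGroup A := N.toNormedAddCommGroup
    U ∈ 𝓝 (1 : Multiplicative A) ↔ ∃ ε > 0, ∀ x : A, N x < ε → Multiplicative.ofAdd x ∈ U := by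
  let _ : NormedAddCommGroup A := N.toNormedAddCommGroup
  have h : U ∈ 𝓝 (1 : Multiplicative A) ↔ (Multiplicative.ofAdd ⁻¹' U) ∈ 𝓝 (0 : A) := Iff.rfl
  rw [h, Metric.mem_nhds_iff]
  simp only [subset_def, mem_ball_zero_iff]
  rfl

theorem continuous_toMultiplicative_of_le (N' : AddGroupNorm A) (N : AddGroupNorm G) (π : A →+ G)
    (h : ∀ a, N (π a) ≤ N' a) :
    letI : NormedAddCommGroup A := N'.toNormedAddCommGroup
    letI : NormedAddCommGroup G := N.toNormedAddCommGroup
    Continuous (AddMonoidHom.toMultiplicative π) := by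
  let _ : NormedAddCommGroup A := N'.toNormedAddCommGroup
  let _ : NormedAddCommGroup G := N.toNormedAddCommGroup
  refine continuous_of_continuousAt_one _ fun U hU => ?_
  rw [map_one, mem_nhds_one_multiplicative_iff] at hU
  obtain ⟨ε, hε, hU⟩ := hU
  rw [Filter.mem_map, mem_nhds_one_multiplicative_iff]
  exact ⟨ε, hε, fun x hx => hU _ ((h x).trans_lt hx)⟩

/-- A subgroup inside a ball contains all multiples of its elements, so testing cyclic subgroups
suffices. -/
theorem NormSSGP.of_small_zmultiples {n : ℕ} {N' : AddGroupNorm A} {N : AddGroupNorm G}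
    (π : A →+ G) (hs : Function.Surjective π) (hle : ∀ a, N (π a) ≤ N' a) {ε : ℝ} (hε : 0 < ε)
    (hsmall : ∀ a, (∀ k : ℤ, N' (k • a) < ε) → π a = 0) (h : NormSSGP (n + 1) N') :
    NormSSGP n N := by
  let _ : NormedAddCommGroup A := N'.toNormedAddCommGroup
  let _ : NormedAddCommGroup G := N.toNormedAddCommGroup
  have h : SSGP (n + 1) (Multiplicative A) := h
  refine SSGP.of_small_subgroups_le_ker (AddMonoidHom.toMultiplicative π)
    (continuous_toMultiplicative_of_le N' N π hle) hs
    (U := {x | N' x.toAdd < ε}) ?_ ?_ h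
  · rw [mem_nhds_one_multiplicative_iff]
    exact ⟨ε, hε, fun x hx => hx⟩
  · intro K hK x hx
    exact hsmall x.toAdd fun k => hK (zpow_mem hx k)

/-- Otherwise the group is discrete and already lies in the lower class. This makes every list `g m`
possible. -/
theorem NormSSGP.exists_small {n : ℕ} {N : AddGroupNorm A} (h : NormSSGP (n + 1) N)
    (h' : ¬ NormSSGP n N) {ε : ℝ} (hε : 0 < ε) : ∃ x, x ≠ 0 ∧ N x < ε := by
  let _ : NormedAddCommGroup A := N.toNormedAddCommGroup
  by_contra! hc
  refine h' (SSGP.of_singleton_mem_nhds (G := Multiplicative A) ?_ h)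
  rw [mem_nhds_one_multiplicative_iff]
  refine ⟨ε, hε, fun x hx => ?_⟩
  by_contra hne
  exact absurd hx (not_lt.2 (hc x hne))

/-- If for every `ε` there are cyclic subgroups inside the `ε`-ball which, together with the image
of `G`, generate `A`, and modulo which `G → A` does not increase norms, then `A` is one class
above `G`. -/
theorem NormSSGP.succ_of_small_generators {n : ℕ} {N' : AddGroupNorm A} {N : AddGroupNorm G}
    (ι : G →+ A) (hT : ∀ ε > 0, ∃ T : Set A, (∀ t ∈ T, ∀ k : ℤ, N' (k • t) < ε) ∧
      (∀ a, ∃ y, a - ι y ∈ AddSubgroup.closure T) ∧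
      ∀ y, ∃ a ∈ AddSubgroup.closure T, N' (a + ι y) ≤ N y)
    (h : NormSSGP n N) : NormSSGP (n + 1) N' := by
  let _ : NormedAddCommGroup A := N'.toNormedAddCommGroup
  let _ : NormedAddCommGroup G := N.toNormedAddCommGroup
  have h : SSGP n (Multiplicative G) := h
  change ∀ U ∈ 𝓝 (1 : Multiplicative A), _
  intro U hU
  rw [mem_nhds_one_multiplicative_iff] at hU
  obtain ⟨ε, hε, hU⟩ := hU
  obtain ⟨T, hTε, hgen, hshift⟩ := hT ε hε
  set 𝓗 : Set (Subgroup (Multiplicative A)) :=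
    (fun t => Subgroup.zpowers (Multiplicative.ofAdd t)) '' T with h𝓗
  have hcl : ∀ a ∈ AddSubgroup.closure T, Multiplicative.ofAdd a ∈
      (Subgroup.closure (⋃ K ∈ 𝓗, (K : Set (Multiplicative A)))).topologicalClosure := by
    intro a ha
    refine Subgroup.le_topologicalClosure _ ?_
    induction ha using AddSubgroup.closure_induction with
    | mem t ht =>
      refine Subgroup.subset_closure (mem_iUnion₂.2 ⟨_, ⟨t, ht, rfl⟩, ?_⟩)
      exact Subgroup.mem_zpowers _
    | zero => exact one_mem _
    | add x y _ _ hx hy => exact mul_mem hx hy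
    | neg x _ hx => exact inv_mem hx
  refine ⟨𝓗, ?_, inferInstance, ?_⟩
  · rintro _ ⟨t, ht, rfl⟩ _ ⟨k, rfl⟩
    exact hU (k • t) (hTε t ht k)
  · set K := (Subgroup.closure (⋃ K ∈ 𝓗, (K : Set (Multiplicative A)))).topologicalClosure
    refine SSGP.map_of_surjective n
      ((QuotientGroup.mk' K).comp (AddMonoidHom.toMultiplicative ι)) ?_ ?_ h
    · refine continuous_of_continuousAt_one _ fun V hV => ?_
      rw [map_one] at hV
      have hV' : (QuotientGroup.mk' K) ⁻¹' V ∈ 𝓝 (1 : Multiplicative A) :=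
        continuous_quotient_mk'.continuousAt.preimage_mem_nhds hV
      rw [mem_nhds_one_multiplicative_iff] at hV'
      obtain ⟨η, hη, hV'⟩ := hV'
      rw [Filter.mem_map, mem_nhds_one_multiplicative_iff]
      refine ⟨η, hη, fun y hy => ?_⟩
      -- `ι` itself need not be continuous: the correction `a` makes the norm small and dies in the
      -- quotient.
      obtain ⟨a, ha, hay⟩ := hshift y
      have h1 := hV' _ (hay.trans_lt hy)
      have h2 : QuotientGroup.mk' K (Multiplicative.ofAdd (a + ι y)) =
          QuotientGroup.mk' K (Multiplicative.ofAdd (ι y)) := by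
        have h3 : QuotientGroup.mk' K (Multiplicative.ofAdd a) = 1 :=
          (QuotientGroup.eq_one_iff _).2 (hcl a ha)
        rw [ofAdd_add, map_mul, h3, one_mul]
      rw [mem_preimage, h2] at h1
      exact h1
    · intro q
      obtain ⟨a, rfl⟩ := QuotientGroup.mk_surjective q
      obtain ⟨y, hy⟩ := hgen a.toAdd
      refine ⟨Multiplicative.ofAdd y, ?_⟩
      refine QuotientGroup.eq.2 ?_
      have h1 := hcl _ hy
      rwa [sub_eq_neg_add] at h1

end NormedGroups

/-! ### H lies in SSGP(1); existence of listings -/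

theorem mem_closure_dyadicUnit (m : ℕ) (h : DyadicStep) :
    h ∈ AddSubgroup.closure {e | ∃ M ≥ m, ∃ t, e = dyadicUnit M t} := by
  obtain ⟨M, hM⟩ := h.exists_isLevel
  rw [DyadicStep.eq_sum_of_isLevel (hM.mono (le_max_left M m))]
  exact AddSubgroup.sum_mem _ fun t _ => AddSubgroup.zsmul_mem _
    (AddSubgroup.subset_closure (show _ ∈ {e | ∃ M ≥ m, ∃ t, e = dyadicUnit M t} from
      ⟨_, le_max_right M m, t, rfl⟩)) _

theorem suppNorm_zsmul_dyadicUnit_le {m M : ℕ} (h : m ≤ M) (t : Fin (2 ^ M)) (k : ℤ) :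
    suppNorm (k • dyadicUnit M t) ≤ (1 / 2) ^ m := by
  rcases eq_or_ne k 0 with rfl | hk
  · rw [zero_zsmul, suppNorm_zero]
    positivity
  · rw [suppNorm_zsmul_dyadicUnit t hk]
    exact pow_le_pow_of_le_one (by norm_num) (by norm_num) h

theorem normSSGP_one_suppGroupNorm : NormSSGP 1 suppGroupNorm := by
  -- H is treated as one step above the trivial group, with `ι = 0`.
  let N₀ : AddGroupNorm PUnit.{1} :=
    { toFun := fun _ => 0, map_zero' := rfl, add_le' := by simp, neg' := fun _ => rfl,
      eq_zero_of_map_eq_zero' := fun _ _ => rfl }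
  have h0 : NormSSGP 0 N₀ := inferInstanceAs (Subsingleton PUnit)
  refine NormSSGP.succ_of_small_generators (N := N₀) 0 (fun ε hε => ?_) h0
  obtain ⟨m, hm⟩ := exists_pow_lt_of_lt_one hε (by norm_num : (1 / 2 : ℝ) < 1)
  refine ⟨{e | ∃ M ≥ m, ∃ t, e = dyadicUnit M t}, ?_, ?_, ?_⟩
  · rintro _ ⟨M, hM, t, rfl⟩ k
    exact (suppNorm_zsmul_dyadicUnit_le hM t k).trans_lt hm
  · exact fun a => ⟨0, mem_closure_dyadicUnit m _⟩
  · exact fun y => ⟨0, zero_mem _, by simp [N₀]⟩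

/-- A nonempty countable set is the range of a sequence; repetitions are harmless since only `r` has
to be injective. -/
theorem exists_isListing {G : Type u} [AddCommGroup G] [Countable G] {N : AddGroupNorm G}
    (h : ∀ ε > 0, ∃ x, x ≠ 0 ∧ N x < ε) : ∃ g r, IsListing N g r := by
  have hg : ∀ m : ℤ, ∃ g : ℕ → G, {x : G | x ≠ 0 ∧ N x ≤ (2 : ℝ) ^ (-m)} = range g := by
    intro m
    refine (to_countable _).exists_eq_range ?_
    obtain ⟨x, hx, hx'⟩ := h ((2 : ℝ) ^ (-m)) (by positivity)
    exact ⟨x, hx, hx'.le⟩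
  choose g hg using hg
  obtain ⟨f, hf⟩ := exists_injective_nat (ℤ × ℕ)
  exact ⟨g, fun m t => f (m, t), fun m => (hg m).symm, hf⟩

/-! ### The inductive step -/

section Step

variable {G : Type u} [AddCommGroup G] {N : AddGroupNorm G} {g : ℤ → ℕ → G} {r : ℤ → ℕ → ℕ}

theorem genSet_ne_zero_and_provNorm_pos (hl : IsListing N g r) {s : DyadicStep × G}
    (hs : s ∈ genSet g r) : s ≠ 0 ∧ 0 < provNorm N s := by
  rcases hs with ⟨m, t, p, hp, rfl⟩ | ⟨m, t, rfl⟩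
  · have hpos : 0 < suppNorm (p • dyadicUnit m t) := by
      rw [suppNorm_zsmul_dyadicUnit t hp]
      positivity
    rw [provNorm_prod_zero]
    refine ⟨fun h => ?_, hpos⟩
    rw [(Prod.mk_eq_zero.1 h).1, suppNorm_zero] at hpos
    exact hpos.false
  · rw [provNorm_listed hl]
    exact ⟨fun h => hl.ne_zero m t (Prod.mk_eq_zero.1 h).2,
      map_pos_of_ne_zero N (hl.ne_zero m t)⟩

/-- The small generators are deep dyadic units, which span `H ⊕ 0`. The correction for `y = g i t`
is the alternating function attached to it. -/
theorem normSSGP_succ_generatedGroupNorm {n : ℕ} (hl : IsListing N g r) (h : NormSSGP n N) :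
    NormSSGP (n + 1) (generatedGroupNorm hl) := by
  refine NormSSGP.succ_of_small_generators (AddMonoidHom.inr DyadicStep G) (fun ε hε => ?_) h
  obtain ⟨m, hm⟩ := exists_pow_lt_of_lt_one hε (by norm_num : (1 / 2 : ℝ) < 1)
  set T : Set (DyadicStep × G) :=
    AddMonoidHom.inl DyadicStep G '' {e | ∃ M ≥ m, ∃ t, e = dyadicUnit M t} with hT
  have hcl : ∀ k : DyadicStep, ((k, 0) : DyadicStep × G) ∈ AddSubgroup.closure T := by
    intro k
    rw [hT, ← AddMonoidHom.map_closure]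
    exact ⟨k, mem_closure_dyadicUnit m k, rfl⟩
  refine ⟨T, ?_, ?_, ?_⟩
  · rintro _ ⟨_, ⟨M, hM, t, rfl⟩, rfl⟩ k
    rcases eq_or_ne k 0 with rfl | hk
    · rwa [zero_zsmul, map_zero]
    refine lt_of_le_of_lt ?_ hm
    have hmem : ((k • dyadicUnit M t, 0) : DyadicStep × G) ∈ genSet g r :=
      Or.inl ⟨M, t, k, hk, rfl⟩
    have h1 : generatedNorm N g r (k • dyadicUnit M t, 0) ≤ _ :=
      generatedNorm_le (costs_of_mem hmem)
    rw [provNorm_prod_zero] at h1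
    have h2 : k • (AddMonoidHom.inl DyadicStep G) (dyadicUnit M t) =
        (k • dyadicUnit M t, 0) := by simp
    rw [h2]
    exact h1.trans (suppNorm_zsmul_dyadicUnit_le hM t k)
  · rintro ⟨k, y⟩
    refine ⟨y, ?_⟩
    simpa using hcl k
  · intro y
    -- The lists omit 0, which needs no correction.
    rcases eq_or_ne y 0 with rfl | hy
    · exact ⟨0, zero_mem _, by rw [map_zero, add_zero, map_zero, map_zero]⟩
    · obtain ⟨i, t, rfl⟩ := hl.exists_eq hy
      refine ⟨(alternating (r i t), 0), hcl _, ?_⟩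
      have hmem : ((alternating (r i t), g i t) : DyadicStep × G) ∈ genSet g r :=
        Or.inr ⟨i, t, rfl⟩
      have h1 : generatedNorm N g r (alternating (r i t), g i t) ≤ _ :=
        generatedNorm_le (costs_of_mem hmem)
      rw [provNorm_listed hl] at h1
      have h2 : ((alternating (r i t), 0) : DyadicStep × G) +
          AddMonoidHom.inr DyadicStep G (g i t) = (alternating (r i t), g i t) := by simp
      rw [h2]
      exact h1

theorem normSSGP_of_generatedGroupNorm [IsAddTorsionFree G] {n : ℕ} (hl : IsListing N g r)
    (h : NormSSGP (n + 1) (generatedGroupNorm hl)) : NormSSGP n N :=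
  NormSSGP.of_small_zmultiples (AddMonoidHom.snd DyadicStep G) Prod.snd_surjective
    (apply_snd_le_generatedNorm hl) (by norm_num : (0 : ℝ) < 1 / 2)
    (fun _ ha => eq_zero_of_zsmul_generatedNorm_lt hl ha) h

end Step

/-! ### Assembling the hierarchy -/

instance DyadicStep.instNontrivial : Nontrivial DyadicStep :=
  ⟨dyadicUnit 0 0, 0, fun h => by
    have h1 := suppNorm_zsmul_dyadicUnit (0 : Fin (2 ^ 0)) one_ne_zero
    rw [one_zsmul, h, suppNorm_zero] at h1
    norm_num at h1⟩

theorem not_normSSGP_zero {A : Type u} [AddCommGroup A] [Nontrivial A] (N : AddGroupNorm A) :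
    ¬ NormSSGP 0 N := by
  intro h
  have h : Subsingleton A := h
  exact not_subsingleton A h

/-- Writing `n = k + 1` carries the bound `n ≥ 1` through the induction and avoids truncated
subtraction. -/
theorem IsStage.properties {n : ℕ} {G : Type} [AddCommGroup G] {N : AddGroupNorm G}
    (h : IsStage n N) : Countable G ∧ IsAddTorsionFree G ∧
      ∃ k, n = k + 1 ∧ NormSSGP (k + 1) N ∧ ¬ NormSSGP k N := by
  induction h with
  | base N hN =>
    obtain rfl : N = suppGroupNorm := DFunLike.ext _ _ hN
    exact ⟨inferInstance, inferInstance, 0, rfl, normSSGP_one_suppGroupNorm, not_normSSGP_zero _⟩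
  | step n N _ g r hgr N' hN' ih =>
    obtain ⟨_, _, k, rfl, h1, h2⟩ := ih
    obtain rfl : N' = generatedGroupNorm hgr := DFunLike.ext _ _ hN'
    exact ⟨inferInstance, inferInstance, k + 1, rfl, normSSGP_succ_generatedGroupNorm hgr h1,
      fun h => h2 (normSSGP_of_generatedGroupNorm hgr h)⟩

theorem exists_isStage (n : ℕ) :
    ∃ (G : Type) (_ : AddCommGroup G) (N : AddGroupNorm G), IsStage (n + 1) N := by
  induction n with
  | zero => exact ⟨DyadicStep, inferInstance, suppGroupNorm, .base _ fun _ => rfl⟩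
  | succ n ih =>
    obtain ⟨G, _, N, hN⟩ := ih
    obtain ⟨_, _, k, -, h1, h2⟩ := hN.properties
    obtain ⟨g, r, hl⟩ := exists_isListing fun ε hε => h1.exists_small h2 hε
    exact ⟨_, inferInstance, generatedGroupNorm hl, .step _ N hN g r hl _ fun _ => rfl⟩

theorem exists_SSGP_succ_not_SSGP (n : ℕ) : ∃ (G : Type) (_ : CommGroup G)
    (_ : TopologicalSpace G) (_ : IsTopologicalGroup G), T2Space G ∧
      TopologicalSpace.MetrizableSpace G ∧ Countable G ∧ IsMulTorsionFree G ∧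
      SSGP (n + 1) G ∧ ¬ SSGP n G := by
  obtain ⟨G, _, N, hN⟩ := exists_isStage n
  obtain ⟨_, _, k, hk, h1, h2⟩ := hN.properties
  obtain rfl : n = k := by omega
  let _ : NormedAddCommGroup G := N.toNormedAddCommGroup
  exact ⟨Multiplicative G, inferInstance, inferInstance, inferInstance,
    inferInstanceAs (T2Space G), inferInstanceAs (TopologicalSpace.MetrizableSpace G),
    inferInstanceAs (Countable G), inferInstance, h1, h2⟩

/-- Closure under continuous images, used in both directions of `ULift`, moves the example to any
universe. -/
theorem exists_SSGP_succ_not_SSGP_ulift (n : ℕ) : ∃ (G : Type u) (_ : Group G)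
    (_ : TopologicalSpace G) (_ : IsTopologicalGroup G),
      T2Space G ∧ SSGP (n + 1) G ∧ ¬ SSGP n G := by
  obtain ⟨G, _, _, _, _, -, -, -, h1, h2⟩ := exists_SSGP_succ_not_SSGP n
  let e : ULift.{u} G ≃* G := MulEquiv.ulift
  have hup : Continuous e.symm.toMonoidHom := continuous_uliftUp
  have hdown : Continuous e.toMonoidHom := continuous_uliftDown
  exact ⟨ULift.{u} G, inferInstance, inferInstance, inferInstance, inferInstance,
    SSGP.map_of_surjective _ _ hup e.symm.surjective h1,
    fun h => h2 (SSGP.map_of_surjective _ _ hdown e.surjective h)⟩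

theorem mainTheorem2 :
    -- for `n ≥ 1` there is an abelian group in `SSGP(n)` but not in `SSGP(n-1)`
    (∀ n : ℕ, 1 ≤ n → ∃ (G : Type) (_ : CommGroup G) (_ : TopologicalSpace G)
      (_ : IsTopologicalGroup G), T2Space G ∧ TopologicalSpace.MetrizableSpace G ∧
        Countable G ∧ IsMulTorsionFree G ∧ SSGP n G ∧ ¬ SSGP (n - 1) G) ∧
    -- the inclusions `SSGP(n) ⊆ SSGP(n+1)` hold and are proper
    (∀ n : ℕ,
      (∀ (G : Type u) [Group G] [TopologicalSpace G] [IsTopologicalGroup G] [T2Space G],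
        SSGP n G → SSGP (n + 1) G) ∧
      ∃ (G : Type u) (_ : Group G) (_ : TopologicalSpace G) (_ : IsTopologicalGroup G),
        T2Space G ∧ SSGP (n + 1) G ∧ ¬ SSGP n G) ∧
    -- the group `H` from which the construction starts
    (Countable DyadicStep ∧ IsAddTorsionFree DyadicStep ∧ Nontrivial DyadicStep ∧
      ∃ N : AddGroupNorm DyadicStep, (∀ h, N h = suppNorm h) ∧ NormSSGP 1 N) ∧
    -- the inductive step, from `G = G_{n+1}` to `H ⊕ G = G_{n+2}`
    (∀ (n : ℕ) (G : Type u) [AddCommGroup G] (N : AddGroupNorm G),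
      Countable G → IsAddTorsionFree G → NormSSGP (n + 1) N → ¬ NormSSGP n N →
      (∃ g r, IsListing N g r) ∧
      ∀ g r, IsListing N g r →
        AddSubgroup.closure (genSet g r) = ⊤ ∧
        (∀ s ∈ genSet g r, s ≠ 0 ∧ 0 < provNorm N s) ∧
        Countable (DyadicStep × G) ∧ IsAddTorsionFree (DyadicStep × G) ∧
        ∃ N' : AddGroupNorm (DyadicStep × G), (∀ x, N' x = generatedNorm N g r x) ∧
          NormSSGP (n + 2) N' ∧ ¬ NormSSGP (n + 1) N') ∧
    -- the groups `G_n` exist for all `n ≥ 1` and have the asserted properties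
    (∀ n : ℕ, 1 ≤ n →
      (∃ (G : Type) (_ : AddCommGroup G) (N : AddGroupNorm G), IsStage n N) ∧
      ∀ (G : Type) [AddCommGroup G] (N : AddGroupNorm G), IsStage n N →
        Countable G ∧ IsAddTorsionFree G ∧ NormSSGP n N ∧ ¬ NormSSGP (n - 1) N) := by
  refine ⟨fun n hn => ?_, fun n => ⟨fun G _ _ _ _ h => h.succ, exists_SSGP_succ_not_SSGP_ulift n⟩,
    ⟨inferInstance, inferInstance, inferInstance, suppGroupNorm, fun _ => rfl,
      normSSGP_one_suppGroupNorm⟩, fun n G _ N _ _ h1 h2 => ⟨?_, fun g r hl => ?_⟩,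
    fun n hn => ⟨?_, fun G _ N hN => ?_⟩⟩
  · obtain ⟨k, rfl⟩ := Nat.exists_eq_add_of_le' hn
    exact exists_SSGP_succ_not_SSGP k
  · exact exists_isListing fun ε hε => h1.exists_small h2 hε
  · exact ⟨closure_genSet hl, fun s hs => genSet_ne_zero_and_provNorm_pos hl hs, inferInstance,
      inferInstance, generatedGroupNorm hl, fun _ => rfl, normSSGP_succ_generatedGroupNorm hl h1,
      fun h => h2 (normSSGP_of_generatedGroupNorm hl h)⟩
  · obtain ⟨k, rfl⟩ := Nat.exists_eq_add_of_le' hn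
    exact exists_isStage k
  · obtain ⟨hc, ht, k, rfl, h1, h2⟩ := hN.properties
    exact ⟨hc, ht, h1, h2⟩
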